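/- Let $V$ be a discrete valuation ring with quotient field $F$, let $K/F$ be a finite Galois extension with group $G$, let $S$ be the integral closure of $V$ in $K$, and assume that $S$ is unramified over $V$ (every maximal ideal of $S$ has ramification index $1$ and separable residue field extension). Let $f : G\times G\to K\setminus\{0\}$ be a normalized two-cocycle, i.e. $\rho(f(\sigma,\tau))\,f(\rho,\sigma\tau)=f(\rho\sigma,\tau)\,f(\rho,\sigma)$ and $f(1,\sigma)=f(\sigma,1)=1$ for all $\rho,\sigma,\tau\in G$, and suppose that all values of $f$ lie in $S$ (they need not be units of $S$). Let $\Sigma_f=\bigoplus_{\sigma\in G}Kx_\sigma$ be the crossed-product $F$-algebra with multiplication determined by $x_\sigma a=\sigma(a)x_\sigma$ $(a\in K)$ and $x_\sigma x_\tau=f(\sigma,\tau)x_{\sigma\tau}$, and let $A_f=\bigoplus_{\sigma\in G}Sx_\sigma\subseteq\Sigma_f$, a $V$-order in $\Sigma_f$ (a $V$-subalgebra of $\Sigma_f$ that is finitely generated as a $V$-module and spans $\Sigma_f$ over $F$). Suppose that $A_f$ is primary, i.e. its Jacobson radical $J(A_f)$ is a maximal two-sided ideal (equivalently, $A_f/J(A_f)$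 is a simple ring). Then $A_f$ is a maximal $V$-order in $\Sigma_f$ (that is, not properly contained in another $V$-order in $\Sigma_f$) if and only if there exists a maximal ideal $M$ of $S$ such that $f(\tau,\tau^{-1})\notin M^2$ for all $\tau$ in the decomposition group $D_M=\{\sigma\in G\mid\sigma(M)=M\}$. -/

import Mathlib

open scoped Pointwise

noncomputable section

/-- A normalized multiplicative two-cocycle `f : G × G → Kˣ`, where `G = Gal(K/F)`. -/
structure NormalizedTwoCocycle (F K : Type*) [Field F] [Field K] [Algebra F K] where
  toFun : Gal(K/F) × Gal(K/F) → Kˣ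
  isMulCocycle : groupCohomology.IsMulCocycle₂ toFun
  map_one_left : ∀ σ : Gal(K/F), toFun (1, σ) = 1
  map_one_right : ∀ σ : Gal(K/F), toFun (σ, 1) = 1

namespace NormalizedTwoCocycle

variable {F K : Type*} [Field F] [Field K] [Algebra F K]

/-- The value `f(σ, τ)`, as an element of `K`. -/
def val (f : NormalizedTwoCocycle F K) (σ τ : Gal(K/F)) : K := (f.toFun (σ, τ) : Kˣ)

theorem val_one_left (f : NormalizedTwoCocycle F K) (σ : Gal(K/F)) : f.val 1 σ = 1 := by
  simp [val, f.map_one_left]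

theorem val_one_right (f : NormalizedTwoCocycle F K) (σ : Gal(K/F)) : f.val σ 1 = 1 := by
  simp [val, f.map_one_right]

theorem val_cocycle (f : NormalizedTwoCocycle F K) (ρ σ τ : Gal(K/F)) :
    f.val (ρ * σ) τ * f.val ρ σ = ρ (f.val σ τ) * f.val ρ (σ * τ) := by
  have h := congrArg (Units.val) (f.isMulCocycle ρ σ τ)
  simpa [val] using h

end NormalizedTwoCocycle

/-- The crossed product `Σ_f = ∑_σ K x_σ = (K/F, G, f)`. The function `a` stands for the element
`∑_σ a(σ) x_σ`. -/
def CrossedProduct {F K : Type*} [Field F] [Field K] [Algebra F K]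
    (_f : NormalizedTwoCocycle F K) : Type _ :=
  Gal(K/F) → K

namespace CrossedProduct

section ring

variable {F K : Type*} [Field F] [Field K] [Algebra F K] {f : NormalizedTwoCocycle F K}

instance : AddCommGroup (CrossedProduct f) :=
  inferInstanceAs (AddCommGroup (Gal(K/F) → K))

@[ext]
theorem ext {a b : CrossedProduct f} (h : ∀ σ : Gal(K/F), a σ = b σ) : a = b := funext h

@[simp] theorem add_apply (a b : CrossedProduct f) (σ : Gal(K/F)) : (a + b) σ = a σ + b σ := rfl

@[simp] theorem zero_apply (σ : Gal(K/F)) : (0 : CrossedProduct f) σ = 0 := rfl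

/-- The identity element `x_1`. -/
instance : One (CrossedProduct f) := ⟨by classical exact fun σ => if σ = 1 then 1 else 0⟩

theorem one_apply [DecidableEq Gal(K/F)] (σ : Gal(K/F)) :
    (1 : CrossedProduct f) σ = if σ = 1 then 1 else 0 := by
  by_cases h : σ = 1
  · rw [if_pos h]; exact if_pos h
  · rw [if_neg h]; exact if_neg h

variable [FiniteDimensional F K]

/-- The multiplication determined by `x_σ s = σ(s) x_σ` and `x_σ x_τ = f(σ, τ) x_{στ}`: the
coefficient at `γ` collects the contributions of all pairs `(σ, τ)` with `σ τ = γ`. -/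
instance : Mul (CrossedProduct f) :=
  ⟨fun a b γ => ∑ σ : Gal(K/F), a σ * σ (b (σ⁻¹ * γ)) * f.val σ (σ⁻¹ * γ)⟩

theorem mul_apply (a b : CrossedProduct f) (γ : Gal(K/F)) :
    (a * b) γ = ∑ σ : Gal(K/F), a σ * σ (b (σ⁻¹ * γ)) * f.val σ (σ⁻¹ * γ) := rfl

protected theorem mul_assoc' (a b c : CrossedProduct f) : a * b * c = a * (b * c) := by
  ext γ
  simp only [mul_apply, Finset.sum_mul, map_sum, Finset.mul_sum]
  rw [Finset.sum_comm]
  refine Finset.sum_congr rfl fun ρ _ => ?_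
  rw [← Equiv.sum_comp (Equiv.mulLeft ρ)]
  refine Finset.sum_congr rfl fun σ _ => ?_
  have h := f.val_cocycle ρ σ (σ⁻¹ * (ρ⁻¹ * γ))
  have e : (ρ * σ)⁻¹ * γ = σ⁻¹ * (ρ⁻¹ * γ) := by group
  simp only [Equiv.coe_mulLeft, inv_mul_cancel_left, mul_inv_cancel_left, e, map_mul,
    AlgEquiv.mul_apply] at h ⊢
  linear_combination a ρ * ρ (b σ) * ρ (σ (c (σ⁻¹ * (ρ⁻¹ * γ)))) * h

instance : Ring (CrossedProduct f) :=
  { (inferInstance : AddCommGroup (CrossedProduct f)),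
    (inferInstance : Mul (CrossedProduct f)),
    (inferInstance : One (CrossedProduct f)) with
    mul_assoc := CrossedProduct.mul_assoc'
    one_mul := fun a => by
      classical
      ext γ
      rw [mul_apply, Finset.sum_eq_single 1]
      · simp [one_apply, f.val_one_left]
      · intro σ _ h; simp [one_apply, h]
      · simp
    mul_one := fun a => by
      classical
      ext γ
      rw [mul_apply, Finset.sum_eq_single γ]
      · simp [one_apply, f.val_one_right]
      · intro σ _ h
        have : ¬ σ⁻¹ * γ = 1 := fun e => h (inv_mul_eq_one.1 e)
        simp [one_apply, this]
      · simp
    left_distrib := fun a b c => by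
      ext γ
      simp only [mul_apply, add_apply, map_add, mul_add, add_mul, Finset.sum_add_distrib]
    right_distrib := fun a b c => by
      ext γ
      simp only [mul_apply, add_apply, add_mul, Finset.sum_add_distrib]
    zero_mul := fun a => by
      ext γ
      simp [mul_apply]
    mul_zero := fun a => by
      ext γ
      simp [mul_apply] }

end ring

section algebra

variable {F K : Type*} [Field F] [Field K] [Algebra F K] {f : NormalizedTwoCocycle F K}
  {R : Type*} [CommRing R] [Algebra R K]

instance : Module R (CrossedProduct f) := inferInstanceAs (Module R (Gal(K/F) → K))

@[simp] theorem smul_apply (r : R) (a : CrossedProduct f) (σ : Gal(K/F)) :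
    (r • a) σ = r • a σ := rfl

variable [Algebra R F] [IsScalarTower R F K]

theorem apply_smul (r : R) (x : K) (σ : Gal(K/F)) : σ (r • x) = r • σ x := by
  rw [← algebraMap_smul F r x, map_smul, algebraMap_smul]

variable [FiniteDimensional F K]

/-- `Σ_f` is an algebra over `F`, and over every ring `R` whose elements act through `F`. -/
instance : Algebra R (CrossedProduct f) :=
  Algebra.ofModule
    (fun r a b => by
      ext γ
      simp [mul_apply, Finset.smul_sum])
    (fun r a b => by
      ext γ
      simp [mul_apply, Finset.smul_sum, apply_smul])

end algebra

end CrossedProduct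

/-- The crossed-product order `A_f = ∑_σ S x_σ` inside `Σ_f`, where `S` is the integral closure of
`V` in `K` and `f` takes values in `S`. -/
def crossedProductOrder (V : Type*) {F K : Type*} [CommRing V] [Field F] [Field K]
    [Algebra V F] [Algebra F K] [Algebra V K] [IsScalarTower V F K] [FiniteDimensional F K]
    (f : NormalizedTwoCocycle F K) (hf : ∀ σ τ : Gal(K/F), f.val σ τ ∈ integralClosure V K) :
    Subalgebra V (CrossedProduct f) where
  carrier := {a | ∀ σ : Gal(K/F), a σ ∈ integralClosure V K}
  add_mem' := fun ha hb σ => add_mem (ha σ) (hb σ)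
  mul_mem' := fun {a b} ha hb γ => by
    rw [CrossedProduct.mul_apply]
    exact sum_mem fun σ _ => mul_mem (mul_mem (ha σ)
      ((hb (σ⁻¹ * γ)).map (σ.toAlgHom.restrictScalars V))) (hf σ (σ⁻¹ * γ))
  algebraMap_mem' := fun r σ => by
    classical
    rw [Algebra.algebraMap_eq_smul_one, CrossedProduct.smul_apply, CrossedProduct.one_apply]
    refine Subalgebra.smul_mem _ ?_ r
    split_ifs
    · exact one_mem _
    · exact zero_mem _

/-- `B` is a `V`-order in the `F`-algebra `A`: a subring of `A` containing `V · 1` that is finitely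
generated as a `V`-module and spans `A` over `F`. -/
structure IsVOrder (V F : Type*) {A : Type*} [CommRing V] [Field F] [Ring A] [Algebra V A]
    [Algebra F A] (B : Subalgebra V A) : Prop where
  fg : B.toSubmodule.FG
  span_eq_top : Submodule.span F (B : Set A) = ⊤

/-- `B` is a maximal `V`-order in `A`: a `V`-order not properly contained in another one. -/
def IsMaximalVOrder (V F : Type*) {A : Type*} [CommRing V] [Field F] [Ring A] [Algebra V A]
    [Algebra F A] (B : Subalgebra V A) : Prop :=
  Maximal (IsVOrder V F (A := A)) B

/-- An order `A` is primary if its Jacobson radical `J(A)` is a maximal two-sided ideal, that is,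
if `A / J(A)` is a simple ring. -/
def IsPrimaryOrder (A : Type*) [Ring A] : Prop :=
  IsSimpleRing (A ⧸ Ring.jacobson A)

/-- The decomposition group `D_M = {σ ∈ Gal(K/F) | σ(M) = M}` of an ideal `M` of the integral
closure `S` of `V` in `K`. -/
def decompositionGroup (V F : Type*) {K : Type*} [CommRing V] [Field F] [Field K]
    [Algebra V F] [Algebra F K] [Algebra V K] [IsScalarTower V F K] [IsFractionRing V F]
    [FiniteDimensional F K] (M : Ideal (integralClosure V K)) : Subgroup Gal(K/F) :=
  (MulAction.stabilizer (integralClosure V K ≃ₐ[V] integralClosure V K) M).comap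
    (galRestrict V F K (integralClosure V K)).toMonoidHom

end

/-! Write v_P for the valuation at a maximal ideal P of S. Under v_P the cocycle identity becomes
additive, with σ moving P to σ⁻¹(P), and gives v_P(f(σ,τ)) ≤ v_P(f(σ,σ⁻¹)): the values f(σ,σ⁻¹)
control all the others.

Necessity. Let J ⊆ A_f consist of the elements whose coefficient at x_σ lies in every P at which
f(σ,σ⁻¹) is a unit. Its left order is a V-order containing A_f (`radicalOrd_mul_le`). If
v_P(f(σ,σ⁻¹)) ≥ 2 for some σ, a suitably extremal such σ (`exists_maximal_of_two_le_ord`) and a c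
with a simple pole at P give an element c x_σ of this left order outside A_f. So maximality forces
the condition at every M, even for all τ in G.

Sufficiency. As S/V is unramified, S-subbimodules of Σ_f are graded (`single_apply_mem`), so an
overorder B is tested on its elements a x_ρ. If ρ fixes P and has order n, the n-th power of a x_ρ
lies in K x_1 ∩ B, hence has integral coefficient; it is a product of n conjugates of a and n - 1
cocycle values of v_P at most 1, which excludes v_P(a) ≤ -1. Any other ρ, at any prime, reduces to
this case on multiplying by x_α and x_β which move the primes at no cost in valuation. Such α and β
exist because A_f is primary (`exists_twist_eq_of_isPrimaryOrder`). -/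

open IsDedekindDomain WithZero

set_option linter.unusedSectionVars false

noncomputable section

/-! ### Valuations on the fraction field and their behaviour under the Galois group. -/

namespace IsDedekindDomain.HeightOneSpectrum

section ord

variable {R K : Type*} [CommRing R] [IsDedekindDomain R] [Field K] [Algebra R K]
  [IsFractionRing R K] (P : HeightOneSpectrum R)

/-- The additive `P`-adic valuation on the fraction field, with the value `0` at `0`. -/
def ord (x : K) : ℤ := -WithZero.log (P.valuation K x)

theorem ord_one : P.ord (1 : K) = 0 := by simp [ord]

theorem ord_mul {x y : K} (hx : x ≠ 0) (hy : y ≠ 0) : P.ord (x * y) = P.ord x + P.ord y := by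
  rw [ord, map_mul, WithZero.log_mul (by simpa using hx) (by simpa using hy), ord, ord]
  ring

theorem valuation_le_exp_neg_iff {x : K} (hx : x ≠ 0) (n : ℤ) :
    P.valuation K x ≤ exp (-n) ↔ n ≤ P.ord x := by
  rw [← WithZero.log_le_iff_le_exp (by simpa using hx), ord]
  omega

theorem le_ord_algebraMap_iff {r : R} (hr : r ≠ 0) (n : ℕ) :
    (n : ℤ) ≤ P.ord (algebraMap R K r) ↔ r ∈ P.asIdeal ^ n := by
  rw [← valuation_le_exp_neg_iff P (by simpa using hr), valuation_of_algebraMap,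
    intValuation_le_pow_iff_mem]

theorem ord_algebraMap_nonneg (r : R) : 0 ≤ P.ord (algebraMap R K r) := by
  by_cases hr : r = 0
  · simp [hr, ord]
  · simpa using (P.le_ord_algebraMap_iff (K := K) hr 0).2 (by simp)

theorem ord_algebraMap_eq_zero_iff {r : R} (hr : r ≠ 0) :
    P.ord (algebraMap R K r) = 0 ↔ r ∉ P.asIdeal := by
  have h := P.le_ord_algebraMap_iff (K := K) hr 1
  have h0 := P.ord_algebraMap_nonneg (K := K) r
  rw [pow_one] at h
  rw [← h]
  push_cast
  omega

theorem mem_range_algebraMap_of_ord_nonneg {x : K}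
    (h : ∀ P : HeightOneSpectrum R, 0 ≤ P.ord x) : x ∈ (algebraMap R K).range := by
  by_cases hx : x = 0
  · simp [hx, zero_mem]
  · exact mem_integers_of_valuation_le_one K x fun P => by
      simpa using (P.valuation_le_exp_neg_iff hx 0).2 (h P)

/-- There is an element with at most a simple pole at `P`, and no other pole, which is not
integral. -/
theorem exists_ord_ge_neg_one : ∃ x : K, x ∉ (algebraMap R K).range ∧
    -1 ≤ P.ord x ∧ ∀ Q : HeightOneSpectrum R, Q ≠ P → 0 ≤ Q.ord x := by
  -- Take x in P⁻¹ outside R. Its poles are bounded by testing x m ∈ R on a uniformizer m at P, and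
  -- on some m in P outside Q.
  obtain ⟨x, hx, hx1⟩ := FractionalIdeal.exists_notMem_one_of_ne_bot (K := K) P.ne_bot
    P.isPrime.ne_top
  rw [FractionalIdeal.mem_one_iff] at hx1
  have hx0 : x ≠ 0 := by rintro rfl; exact hx1 ⟨0, map_zero _⟩
  rw [FractionalIdeal.mem_inv_iff (by simpa using P.ne_bot)] at hx
  have key : ∀ (Q : HeightOneSpectrum R) (m : R), m ≠ 0 → m ∈ P.asIdeal →
      0 ≤ Q.ord x + Q.ord (algebraMap R K m) := by
    intro Q m hm0 hm
    have h := hx _ ((FractionalIdeal.mem_coeIdeal _).2 ⟨m, hm, rfl⟩)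
    rw [FractionalIdeal.mem_one_iff] at h
    obtain ⟨r, hr⟩ := h
    rw [← ord_mul Q hx0 (by simpa using hm0), ← hr]
    exact Q.ord_algebraMap_nonneg r
  refine ⟨x, hx1, ?_, fun Q hQ => ?_⟩
  · obtain ⟨m, hm⟩ := P.intValuation_exists_uniformizer
    have hm0 : m ≠ 0 := by
      rintro rfl
      rw [map_zero] at hm
      exact exp_ne_zero hm.symm
    have h1 : P.ord (algebraMap R K m) = 1 := by
      rw [ord, valuation_of_algebraMap, hm]; simp
    have := key P m hm0 (by
      rw [← pow_one P.asIdeal, ← intValuation_le_pow_iff_mem, hm]; simp)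
    omega
  · have : ¬ P.asIdeal ≤ Q.asIdeal := fun h =>
      hQ (HeightOneSpectrum.ext (P.isMaximal.eq_of_le Q.isPrime.ne_top h).symm)
    obtain ⟨m, hm, hmQ⟩ := Set.not_subset.1 this
    have hm0 : m ≠ 0 := by rintro rfl; exact hmQ (zero_mem _)
    have h0 := (Q.ord_algebraMap_eq_zero_iff (K := K) hm0).2 hmQ
    have := key Q m hm0 hm
    omega

end ord

section galois

variable {V F K : Type*} [CommRing V] [Field F] [Field K] [Algebra V F] [Algebra F K] [Algebra V K]
  [IsScalarTower V F K] [IsFractionRing V F] [FiniteDimensional F K]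

/-- The prime `σ⁻¹(P)`. -/
def twist (σ : Gal(K/F)) (P : HeightOneSpectrum (integralClosure V K)) :
    HeightOneSpectrum (integralClosure V K) where
  asIdeal := P.asIdeal.comap (galRestrict V F K (integralClosure V K) σ)
  isPrime := P.isPrime.comap _
  ne_bot := by
    obtain ⟨x, hx, hx0⟩ := Submodule.exists_mem_ne_zero_of_ne_bot P.ne_bot
    refine (Submodule.ne_bot_iff _).2
      ⟨(galRestrict V F K (integralClosure V K) σ).symm x, ?_, by simpa using hx0⟩
    rw [Ideal.mem_comap]
    simpa using hx

theorem mem_twist_iff (σ : Gal(K/F)) (P : HeightOneSpectrum (integralClosure V K))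
    (s : integralClosure V K) : s ∈ (twist σ P).asIdeal ↔
      galRestrict V F K (integralClosure V K) σ s ∈ P.asIdeal := Iff.rfl

theorem twist_one (P : HeightOneSpectrum (integralClosure V K)) :
    twist (1 : Gal(K/F)) P = P := by
  ext s
  rw [mem_twist_iff, map_one]; rfl

theorem twist_mul (σ τ : Gal(K/F)) (P : HeightOneSpectrum (integralClosure V K)) :
    twist (σ * τ) P = twist τ (twist σ P) := by
  ext s
  simp only [mem_twist_iff, map_mul]; rfl

theorem mem_decompositionGroup_iff {σ : Gal(K/F)} {P : HeightOneSpectrum (integralClosure V K)} :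
    σ ∈ decompositionGroup V F P.asIdeal ↔ twist σ P = P := by
  have h : σ ∈ decompositionGroup V F P.asIdeal ↔
      galRestrict V F K (integralClosure V K) σ • P.asIdeal = P.asIdeal := Iff.rfl
  rw [h, ← eq_inv_smul_iff, HeightOneSpectrum.ext_iff, eq_comm]
  refine Eq.congr ?_ rfl
  ext s
  rw [Ideal.mem_inv_pointwise_smul_iff]
  rfl

theorem mem_twist_pow_iff (σ : Gal(K/F)) (P : HeightOneSpectrum (integralClosure V K))
    (s : integralClosure V K) (n : ℕ) : s ∈ (twist σ P).asIdeal ^ n ↔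
      galRestrict V F K (integralClosure V K) σ s ∈ P.asIdeal ^ n := by
  have : (twist σ P).asIdeal ^ n =
      (P.asIdeal ^ n).comap (galRestrict V F K (integralClosure V K) σ) := by
    change (P.asIdeal.comap (galRestrict V F K (integralClosure V K) σ).toRingEquiv) ^ n =
      (P.asIdeal ^ n).comap (galRestrict V F K (integralClosure V K) σ).toRingEquiv
    rw [← Ideal.map_symm, ← Ideal.map_symm, Ideal.map_pow]
  rw [this, Ideal.mem_comap]

variable [IsDedekindDomain (integralClosure V K)] [IsFractionRing (integralClosure V K) K]

theorem ord_apply (σ : Gal(K/F)) (P : HeightOneSpectrum (integralClosure V K)) (x : K) :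
    P.ord (σ x) = (twist σ P).ord x := by
  have key : ∀ s : integralClosure V K, s ≠ 0 → P.ord (σ (s : K)) = (twist σ P).ord (s : K) := by
    intro s hs
    have e : σ (s : K) = algebraMap _ K (galRestrict V F K (integralClosure V K) σ s) := by
      rw [algebraMap_galRestrict_apply]; rfl
    -- On S both valuations are natural numbers, determined by membership in the powers of the
    -- prime; these memberships correspond under σ.
    have h := fun n : ℕ => P.le_ord_algebraMap_iff (K := K)
      (r := galRestrict V F K (integralClosure V K) σ s) (by simpa using hs) n
    have h' := fun n : ℕ => (twist σ P).le_ord_algebraMap_iff (K := K) hs n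
    simp only [mem_twist_pow_iff, ← h, ← e] at h'
    have h1 := P.ord_algebraMap_nonneg (K := K) (galRestrict V F K (integralClosure V K) σ s)
    have h2 := (twist σ P).ord_algebraMap_nonneg (K := K) s
    rw [← e] at h1
    obtain ⟨a, ha⟩ := Int.eq_ofNat_of_zero_le h1
    obtain ⟨b, hb⟩ := Int.eq_ofNat_of_zero_le h2
    have ha' := h' a
    have hb' := h' b
    change _ ≤ (twist σ P).ord (s : K) ↔ _ at ha'
    change _ ≤ (twist σ P).ord (s : K) ↔ _ at hb'
    change (twist σ P).ord (s : K) = _ at hb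
    omega
  by_cases hx : x = 0
  · simp [hx, ord]
  obtain ⟨a, b, hb, rfl⟩ := IsFractionRing.div_surjective (A := integralClosure V K) x
  have hb0 : b ≠ 0 := nonZeroDivisors.ne_zero hb
  have ha0 : a ≠ 0 := by rintro rfl; simp at hx
  have hbK : algebraMap (integralClosure V K) K b ≠ 0 := by simpa using hb0
  have hbσ : σ (algebraMap (integralClosure V K) K b) ≠ 0 := by
    rwa [ne_eq, EmbeddingLike.map_eq_zero_iff]
  have h1 := P.ord_mul (x := σ (algebraMap (integralClosure V K) K a /
    algebraMap (integralClosure V K) K b)) (by rwa [ne_eq, EmbeddingLike.map_eq_zero_iff]) hbσ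
  have h2 := (twist σ P).ord_mul hx hbK
  rw [← map_mul] at h1
  rw [div_mul_cancel₀ _ hbK] at h1 h2
  have hka : P.ord (σ (algebraMap (integralClosure V K) K a)) =
    (twist σ P).ord (algebraMap (integralClosure V K) K a) := key a ha0
  have hkb : P.ord (σ (algebraMap (integralClosure V K) K b)) =
    (twist σ P).ord (algebraMap (integralClosure V K) K b) := key b hb0
  omega

end galois

end IsDedekindDomain.HeightOneSpectrum

/-! ### Valuations of the cocycle. -/

namespace NormalizedTwoCocycle

variable {V F K : Type*} [CommRing V] [Field F] [Field K] [Algebra V F] [Algebra F K] [Algebra V K]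
  [IsScalarTower V F K] [IsFractionRing V F] [FiniteDimensional F K]
  [IsDedekindDomain (integralClosure V K)] [IsFractionRing (integralClosure V K) K]

theorem val_ne_zero (f : NormalizedTwoCocycle F K) (σ τ : Gal(K/F)) : f.val σ τ ≠ 0 :=
  Units.ne_zero _

/-- The `P`-adic valuation of `f(σ, τ)`. -/
def ord (f : NormalizedTwoCocycle F K) (P : HeightOneSpectrum (integralClosure V K))
    (σ τ : Gal(K/F)) : ℤ :=
  P.ord (f.val σ τ)

variable (f : NormalizedTwoCocycle F K) (P : HeightOneSpectrum (integralClosure V K))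

theorem ord_cocycle (ρ σ τ : Gal(K/F)) :
    f.ord P (ρ * σ) τ + f.ord P ρ σ = f.ord (P.twist ρ) σ τ + f.ord P ρ (σ * τ) := by
  have h := congrArg P.ord (f.val_cocycle ρ σ τ)
  rwa [P.ord_mul (f.val_ne_zero _ _) (f.val_ne_zero _ _),
    P.ord_mul (by simpa using f.val_ne_zero σ τ) (f.val_ne_zero _ _),
    HeightOneSpectrum.ord_apply] at h

@[simp] theorem ord_one_left (σ : Gal(K/F)) : f.ord P 1 σ = 0 := by
  rw [ord, f.val_one_left, P.ord_one]

@[simp] theorem ord_one_right (σ : Gal(K/F)) : f.ord P σ 1 = 0 := by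
  rw [ord, f.val_one_right, P.ord_one]

theorem ord_inv_twist (σ : Gal(K/F)) : f.ord (P.twist σ) σ⁻¹ σ = f.ord P σ σ⁻¹ := by
  have h := f.ord_cocycle P σ σ⁻¹ σ
  simp only [mul_inv_cancel, inv_mul_cancel, ord_one_left, ord_one_right] at h
  omega

/-- The cocycle identity for (σ⁻¹, σ, τ), read at σ⁻¹(P). For integral f both summands are
nonnegative, whence `ord_le_left`. -/
theorem ord_inv_add (σ τ : Gal(K/F)) :
    f.ord P σ τ + f.ord (P.twist σ) σ⁻¹ (σ * τ) = f.ord P σ σ⁻¹ := by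
  have h := f.ord_cocycle (P.twist σ) σ⁻¹ σ τ
  simp only [inv_mul_cancel, ord_one_left, ← HeightOneSpectrum.twist_mul, mul_inv_cancel,
    HeightOneSpectrum.twist_one, ord_inv_twist] at h
  omega

theorem ord_add_mul_inv (σ τ : Gal(K/F)) :
    f.ord P (σ * τ) τ⁻¹ + f.ord P σ τ = f.ord (P.twist σ) τ τ⁻¹ := by
  simpa using f.ord_cocycle P σ τ τ⁻¹

theorem ord_add_ord_mul_inv (σ τ : Gal(K/F)) :
    f.ord P (σ * τ) (σ * τ)⁻¹ + f.ord P σ τ = f.ord (P.twist σ) τ (σ * τ)⁻¹ + f.ord P σ σ⁻¹ := by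
  simpa using f.ord_cocycle P σ τ (σ * τ)⁻¹

/-- The `P`-adic valuation of the coefficient of the radical of `A_f` at `x_σ`. -/
def radicalOrd (σ : Gal(K/F)) : ℤ := if f.ord P σ σ⁻¹ = 0 then 1 else 0

theorem radicalOrd_nonneg (σ : Gal(K/F)) : 0 ≤ f.radicalOrd P σ := by
  unfold radicalOrd; split_ifs <;> norm_num

theorem radicalOrd_le_one (σ : Gal(K/F)) : f.radicalOrd P σ ≤ 1 := by
  unfold radicalOrd; split_ifs <;> norm_num

theorem ord_nonneg (hf : ∀ σ τ : Gal(K/F), f.val σ τ ∈ integralClosure V K)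
    (σ τ : Gal(K/F)) : 0 ≤ f.ord P σ τ :=
  P.ord_algebraMap_nonneg (K := K) (⟨f.val σ τ, hf σ τ⟩ : integralClosure V K)

theorem ord_le_left (hf : ∀ σ τ : Gal(K/F), f.val σ τ ∈ integralClosure V K)
    (σ τ : Gal(K/F)) : f.ord P σ τ ≤ f.ord P σ σ⁻¹ := by
  have h := f.ord_inv_add P σ τ
  have := f.ord_nonneg (P.twist σ) hf σ⁻¹ (σ * τ)
  omega

theorem ord_le_right (hf : ∀ σ τ : Gal(K/F), f.val σ τ ∈ integralClosure V K)
    (σ τ : Gal(K/F)) : f.ord P σ τ ≤ f.ord (P.twist σ) τ τ⁻¹ := by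
  have h := f.ord_add_mul_inv P σ τ
  have := f.ord_nonneg P hf (σ * τ) τ⁻¹
  omega

/-- Only one case could fail: f(στ,(στ)⁻¹) and f(σ,τ) units at P, but f(τ,τ⁻¹) not a unit at σ⁻¹(P).
Then `h5` makes f(σ,σ⁻¹) a unit at P and f(τ,(στ)⁻¹) one at σ⁻¹(P), and `h6` contradicts the
assumption on τ. -/
theorem radicalOrd_mul_le (hf : ∀ σ τ : Gal(K/F), f.val σ τ ∈ integralClosure V K)
    (σ τ : Gal(K/F)) :
    f.radicalOrd P (σ * τ) ≤ f.radicalOrd (P.twist σ) τ + f.ord P σ τ := by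
  have h0 := f.ord_nonneg P hf σ τ
  have h1 := f.ord_nonneg P hf σ σ⁻¹
  have h2 := f.ord_nonneg (P.twist σ) hf τ τ⁻¹
  have h3 := f.ord_nonneg P hf (σ * τ) (σ * τ)⁻¹
  have h4 := f.ord_nonneg (P.twist σ) hf τ (σ * τ)⁻¹
  have h5 := f.ord_add_ord_mul_inv P σ τ
  have h6 := f.ord_cocycle (P.twist σ) τ (σ * τ)⁻¹ σ
  have h7 := f.ord_le_right (P.twist σ) hf (τ * (σ * τ)⁻¹) σ
  have e : τ * (σ * τ)⁻¹ = σ⁻¹ := by group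
  have e' : (σ * τ)⁻¹ * σ = τ⁻¹ := by group
  rw [e, e', ord_inv_twist] at h6
  have h8 := f.ord_nonneg ((P.twist σ).twist τ) hf (σ * τ)⁻¹ σ
  unfold radicalOrd
  split_ifs <;> omega

/-- If `f(σ, σ⁻¹) ∈ P²` for some `σ`, then there is such a `σ` for which `f(σ, τ)` is a unit at `P`
only for those `τ` for which `f(τ, τ⁻¹)` is a unit at `σ⁻¹(P)`. -/
theorem exists_maximal_of_two_le_ord (hf : ∀ σ τ : Gal(K/F), f.val σ τ ∈ integralClosure V K)
    {σ₀ : Gal(K/F)} (h₀ : 2 ≤ f.ord P σ₀ σ₀⁻¹) :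
    ∃ σ : Gal(K/F), 2 ≤ f.ord P σ σ⁻¹ ∧
      ∀ τ : Gal(K/F), f.ord P σ τ = 0 → f.ord (P.twist σ) τ τ⁻¹ = 0 := by
  -- If f(σ,τ) is a unit at P, then στ is again a competitor, and its sum exceeds that of σ by the
  -- sum over γ of the valuations of f(τ,γ) at σ⁻¹(P). Maximality makes all of these vanish, in
  -- particular the one at γ = τ⁻¹.
  obtain ⟨σ, hσ, hmax⟩ := Set.exists_max_image {σ : Gal(K/F) | 2 ≤ f.ord P σ σ⁻¹}
    (fun σ => ∑ γ, f.ord P σ γ) (Set.toFinite _) ⟨σ₀, h₀⟩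
  refine ⟨σ, hσ, fun τ hτ => ?_⟩
  have hτ' := f.ord_add_ord_mul_inv P σ τ
  have h4 := f.ord_nonneg (P.twist σ) hf τ (σ * τ)⁻¹
  have h2 : 2 ≤ f.ord P σ σ⁻¹ := hσ
  have h := hmax (σ * τ) (show 2 ≤ f.ord P (σ * τ) (σ * τ)⁻¹ by omega)
  have e : ∑ γ, f.ord P (σ * τ) γ = ∑ γ, f.ord (P.twist σ) τ γ + ∑ γ, f.ord P σ γ := by
    rw [← Equiv.sum_comp (Equiv.mulLeft τ) (fun γ => f.ord P σ γ), ← Finset.sum_add_distrib]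
    refine Finset.sum_congr rfl fun γ _ => ?_
    have := f.ord_cocycle P σ τ γ
    simp only [Equiv.coe_mulLeft]
    omega
  have h5 : f.ord (P.twist σ) τ τ⁻¹ ≤ ∑ γ, f.ord (P.twist σ) τ γ :=
    Finset.single_le_sum (f := fun γ => f.ord (P.twist σ) τ γ)
      (fun γ _ => f.ord_nonneg (P.twist σ) hf τ γ) (Finset.mem_univ τ⁻¹)
  have h6 := f.ord_nonneg (P.twist σ) hf τ τ⁻¹
  change ∑ γ, f.ord P (σ * τ) γ ≤ ∑ γ, f.ord P σ γ at h
  omega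

/-- Multiplication by `c x_σ`, where `c` has a simple pole at `P`, preserves the radical, for
`σ` as in `exists_maximal_of_two_le_ord`. -/
theorem radicalOrd_mul_add_one_le (hf : ∀ σ τ : Gal(K/F), f.val σ τ ∈ integralClosure V K)
    {σ : Gal(K/F)} (hσ : 2 ≤ f.ord P σ σ⁻¹)
    (h : ∀ τ : Gal(K/F), f.ord P σ τ = 0 → f.ord (P.twist σ) τ τ⁻¹ = 0) (τ : Gal(K/F)) :
    f.radicalOrd P (σ * τ) + 1 ≤ f.radicalOrd (P.twist σ) τ + f.ord P σ τ := by
  have h0 := f.ord_nonneg P hf σ τ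
  have h4 := f.ord_nonneg (P.twist σ) hf τ (σ * τ)⁻¹
  have h5 := f.ord_add_ord_mul_inv P σ τ
  have hτ := h τ
  -- If f(σ,τ) has order 0, `hτ` gives τ radical order 1 and `h5` gives στ radical order 0. If it
  -- has order 1, `h5` still gives στ radical order 0. From order 2 on, the bound `radicalOrd` ≤ 1
  -- suffices.
  unfold radicalOrd
  split_ifs <;> omega

end NormalizedTwoCocycle

/-! ### Homogeneous elements, and the grading of bimodules from unramifiedness. -/

namespace CrossedProduct

section single

variable {F K : Type*} [Field F] [Field K] [Algebra F K] {f : NormalizedTwoCocycle F K}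

open Classical in
/-- The element `c x_σ`. -/
def single (σ : Gal(K/F)) (c : K) : CrossedProduct f := Pi.single (M := fun _ => K) σ c

@[simp] theorem single_same (σ : Gal(K/F)) (c : K) : (single σ c : CrossedProduct f) σ = c := by
  simp [single]

theorem single_of_ne {σ τ : Gal(K/F)} (h : τ ≠ σ) (c : K) :
    (single σ c : CrossedProduct f) τ = 0 := by
  simp [single, h]

theorem one_eq_single : (1 : CrossedProduct f) = single 1 1 := by
  classical
  ext σ
  by_cases h : σ = 1
  · subst h; simp [one_apply]
  · simp [one_apply, h, single_of_ne h]

@[simp] theorem sum_apply {ι : Type*} (s : Finset ι) (a : ι → CrossedProduct f) (σ : Gal(K/F)) :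
    (∑ i ∈ s, a i) σ = ∑ i ∈ s, a i σ :=
  map_sum (Pi.evalAddMonoidHom (fun _ : Gal(K/F) => K) σ) a s

theorem smul_single {R : Type*} [CommRing R] [Algebra R K] (r : R) (σ : Gal(K/F)) (c : K) :
    r • (single σ c : CrossedProduct f) = single σ (r • c) := by
  ext τ
  by_cases h : τ = σ
  · subst h; simp
  · simp [single_of_ne h]

variable [FiniteDimensional F K]

theorem sum_single (a : CrossedProduct f) : ∑ σ, single σ (a σ) = a := by
  ext τ
  refine (sum_apply _ _ _).trans ((Finset.sum_eq_single τ (fun σ _ h => ?_) (by simp)).trans ?_)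
  · exact single_of_ne h.symm _
  · exact single_same _ _

theorem single_mul_apply (σ : Gal(K/F)) (c : K) (a : CrossedProduct f) (γ : Gal(K/F)) :
    (single σ c * a : CrossedProduct f) γ = c * σ (a (σ⁻¹ * γ)) * f.val σ (σ⁻¹ * γ) := by
  rw [mul_apply, Finset.sum_eq_single σ (fun τ _ h => by rw [single_of_ne h]; simp) (by simp),
    single_same]

theorem single_one_mul_apply (c : K) (a : CrossedProduct f) (γ : Gal(K/F)) :
    (single 1 c * a : CrossedProduct f) γ = c * a γ := by
  simp [single_mul_apply, f.val_one_left]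

theorem mul_single_one_apply (c : K) (a : CrossedProduct f) (γ : Gal(K/F)) :
    (a * single 1 c : CrossedProduct f) γ = a γ * γ c := by
  rw [mul_apply, Finset.sum_eq_single γ (fun τ _ h => by
    rw [single_of_ne (fun e => h (inv_mul_eq_one.1 e))]; simp) (by simp)]
  simp [f.val_one_right]

theorem single_mul_single (σ τ : Gal(K/F)) (c d : K) :
    (single σ c * single τ d : CrossedProduct f) = single (σ * τ) (c * σ d * f.val σ τ) := by
  ext γ
  rw [single_mul_apply]
  by_cases h : γ = σ * τ
  · subst h; simp
  · rw [single_of_ne h, single_of_ne fun e => h (by rw [← e, mul_inv_cancel_left])]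
    simp

theorem algebraMap_eq_single {R : Type*} [CommRing R] [Algebra R K] [Algebra R F]
    [IsScalarTower R F K] (r : R) :
    algebraMap R (CrossedProduct f) r = single 1 (algebraMap R K r) := by
  rw [Algebra.algebraMap_eq_smul_one, one_eq_single, smul_single, Algebra.algebraMap_eq_smul_one]

end single

section unramified

variable (V F : Type*) {K : Type*} [CommRing V] [Field F] [Field K] [Algebra V F] [Algebra F K]
  [Algebra V K] [IsScalarTower V F K] [IsFractionRing V F] [FiniteDimensional F K]
  [IsFractionRing (integralClosure V K) K]
  [Algebra.FormallyUnramified V (integralClosure V K)] [Module.Finite V (integralClosure V K)]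

/-- The Galois coordinates of an unramified extension. -/
theorem exists_sum_mul_apply_eq [DecidableEq Gal(K/F)] :
    ∃ (n : ℕ) (a b : Fin n → integralClosure V K), ∀ σ : Gal(K/F),
      ∑ i, (a i : K) * σ (b i : K) = if σ = 1 then 1 else 0 := by
  set S := integralClosure V K
  obtain ⟨n, a, b, h⟩ : ∃ (n : ℕ) (a b : Fin n → S),
      Algebra.FormallyUnramified.elem V S = ∑ i, a i ⊗ₜ[V] b i := by
    obtain ⟨t, ht⟩ := TensorProduct.exists_finset (Algebra.FormallyUnramified.elem V S)
    refine ⟨t.card, fun i => (t.equivFin.symm i).1.1, fun i => (t.equivFin.symm i).1.2, ?_⟩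
    rw [ht, ← Finset.sum_coe_sort t (fun i => i.1 ⊗ₜ[V] i.2), ← Equiv.sum_comp t.equivFin.symm]
  refine ⟨n, a, b, fun σ => ?_⟩
  -- Evaluate the separability element e along s ⊗ t ↦ s σ(t). Since (1 ⊗ s - s ⊗ 1) e = 0, also
  -- (σ(s) - s) φ(e) = 0, so φ(e) = 0 as soon as σ moves some s.
  let φ : TensorProduct V S S →ₐ[V] K := Algebra.TensorProduct.lift S.val
    ((σ.toAlgHom.restrictScalars V).comp S.val) (fun _ _ => mul_comm _ _)
  have hφ : ∀ x y : S, φ (x ⊗ₜ y) = (x : K) * σ (y : K) := fun x y => rfl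
  have h1 : φ (Algebra.FormallyUnramified.elem V S) = ∑ i, (a i : K) * σ (b i : K) := by
    rw [h, map_sum]; rfl
  rw [← h1]
  split_ifs with hσ
  · have h2 := Algebra.FormallyUnramified.lmul_elem (R := V) (S := S)
    rw [h, map_sum] at h2
    rw [h1]
    simpa [hσ] using congrArg (S.val) h2
  · have : ∃ s : S, σ (s : K) ≠ s := by
      by_contra! hs
      refine hσ (AlgEquiv.ext fun x => ?_)
      obtain ⟨u, v, -, rfl⟩ := IsFractionRing.div_surjective (A := S) x
      rw [map_div₀]
      exact congrArg₂ _ (hs u) (hs v)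
    obtain ⟨s, hs⟩ := this
    have h2 := congrArg φ (Algebra.FormallyUnramified.one_tmul_mul_elem (R := V) s)
    rw [map_mul, map_mul, hφ, hφ] at h2
    have h3 : (σ (s : K) - s) * φ (Algebra.FormallyUnramified.elem V S) = 0 := by
      simpa [sub_mul, sub_eq_zero] using h2
    exact (mul_eq_zero.1 h3).resolve_left (sub_ne_zero.2 hs)

variable {F} {f : NormalizedTwoCocycle F K}

/-- Every `S`-subbimodule of `Σ_f` is graded. -/
theorem single_apply_mem (B : AddSubgroup (CrossedProduct f))
    (hl : ∀ s ∈ integralClosure V K, ∀ b ∈ B, single 1 s * b ∈ B)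
    (hr : ∀ s ∈ integralClosure V K, ∀ b ∈ B, b * single 1 s ∈ B)
    {b : CrossedProduct f} (hb : b ∈ B) (σ : Gal(K/F)) : single σ (b σ) ∈ B := by
  classical
  obtain ⟨n, x, y, hxy⟩ := exists_sum_mul_apply_eq V F (K := K)
  -- The coefficient of the sum at x_τ is b(τ) ∑ x_i (τσ⁻¹)(y_i), which vanishes unless τ = σ: the
  -- Galois coordinates project onto one component.
  have : single σ (b σ) = ∑ i, (single 1 (x i : K) * (b * single 1 (σ⁻¹ (y i : K))) : CrossedProduct f) := by
    ext τ
    have h := hxy (τ * σ⁻¹)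
    have e : ∀ i, (single 1 (x i : K) * (b * single 1 (σ⁻¹ (y i : K))) : CrossedProduct f) τ =
        b τ * ((x i : K) * (τ * σ⁻¹) (y i : K)) := fun i => by
      rw [single_one_mul_apply, mul_single_one_apply, AlgEquiv.mul_apply]; ring
    refine Eq.trans ?_ (sum_apply _ _ _).symm
    rw [Finset.sum_congr rfl fun i _ => e i, ← Finset.mul_sum, h]
    by_cases hτ : τ = σ
    · subst hτ; simp
    · rw [single_of_ne hτ, if_neg (by rwa [mul_inv_eq_one]), mul_zero]
  rw [this]
  exact sum_mem fun i _ => hl _ (x i).2 _ (hr _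
    ((y i).2.map ((σ⁻¹ : Gal(K/F)).toAlgHom.restrictScalars V)) _ hb)

end unramified

end CrossedProduct

/-! ### The crossed-product order is an order. -/

section orders

variable {V F K : Type*} [CommRing V] [Field F] [Field K] [Algebra V F] [Algebra F K]
  [Algebra V K] [IsScalarTower V F K] [IsFractionRing V F] [FiniteDimensional F K]
  {f : NormalizedTwoCocycle F K} {hf : ∀ σ τ : Gal(K/F), f.val σ τ ∈ integralClosure V K}

open CrossedProduct

theorem single_mem_crossedProductOrder {σ : Gal(K/F)} {c : K} :
    single σ c ∈ crossedProductOrder V f hf ↔ c ∈ integralClosure V K := by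
  refine ⟨fun h => by simpa using h σ, fun h τ => ?_⟩
  by_cases e : τ = σ
  · subst e; simpa using h
  · rw [single_of_ne e]; exact zero_mem _

theorem isVOrder_crossedProductOrder [IsDomain V] [Module.Finite V (integralClosure V K)]
    [IsFractionRing (integralClosure V K) K] :
    IsVOrder V F (crossedProductOrder V f hf) := by
  constructor
  · let φ : (Gal(K/F) → integralClosure V K) →ₗ[V] CrossedProduct f :=
      { toFun := fun g σ => (g σ : K)
        map_add' := fun _ _ => rfl
        map_smul' := fun _ _ => rfl }
    have : Subalgebra.toSubmodule (crossedProductOrder V f hf) = LinearMap.range φ := by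
      ext a
      refine ⟨fun h => ⟨fun σ => ⟨a σ, h σ⟩, rfl⟩, ?_⟩
      rintro ⟨g, rfl⟩
      exact fun σ => (g σ).2
    rw [this, LinearMap.range_eq_map]
    exact Module.Finite.fg_top.map φ
  · refine eq_top_iff.2 fun a _ => ?_
    rw [← sum_single a]
    refine sum_mem fun σ _ => ?_
    have : Algebra.IsAlgebraic V K :=
      (IsFractionRing.comap_isAlgebraic_iff (A := V) (K := F) (C := K)).2 inferInstance
    obtain ⟨y, hy, h⟩ := (this.isAlgebraic (a σ)).exists_integral_multiple
    have hy0 : algebraMap V F y ≠ 0 := by simpa using hy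
    have : single σ (a σ) = (algebraMap V F y)⁻¹ • (single σ (y • a σ) : CrossedProduct f) := by
      rw [smul_single, ← algebraMap_smul F y, smul_smul, inv_mul_cancel₀ hy0, one_smul]
    rw [this]
    exact Submodule.smul_mem _ _ (Submodule.subset_span (single_mem_crossedProductOrder.2 h))

end orders

/-! ### Necessity: the left order of the radical. -/

/-- The ring of elements which stabilize a lattice by left multiplication. -/
def Submodule.leftOrder {R A : Type*} [CommRing R] [Ring A] [Algebra R A] (J : Submodule R A) :
    Subalgebra R A where
  carrier := {x | ∀ a ∈ J, x * a ∈ J}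
  mul_mem' := fun hx hy a ha => by rw [mul_assoc]; exact hx _ (hy _ ha)
  add_mem' := fun hx hy a ha => by rw [add_mul]; exact J.add_mem (hx _ ha) (hy _ ha)
  algebraMap_mem' := fun r a ha => by rw [← Algebra.smul_def]; exact J.smul_mem _ ha

section

variable {V F K : Type*} [CommRing V] [Field F] [Field K] [Algebra V F] [Algebra F K]
  [Algebra V K] [IsScalarTower V F K] [IsFractionRing V F] [FiniteDimensional F K]
  [IsDedekindDomain (integralClosure V K)] [IsFractionRing (integralClosure V K) K]
  (f : NormalizedTwoCocycle F K)

open CrossedProduct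

theorem mem_integralClosure_of_ord_nonneg {x : K}
    (h : ∀ P : HeightOneSpectrum (integralClosure V K), 0 ≤ P.ord x) : x ∈ integralClosure V K := by
  obtain ⟨s, rfl⟩ := HeightOneSpectrum.mem_range_algebraMap_of_ord_nonneg h
  exact s.2

theorem ord_nonneg_of_mem_integralClosure {x : K} (hx : x ∈ integralClosure V K)
    (P : HeightOneSpectrum (integralClosure V K)) : 0 ≤ P.ord x :=
  P.ord_algebraMap_nonneg (K := K) (⟨x, hx⟩ : integralClosure V K)

variable (V) in
/-- The radical of `A_f`: the coefficient at `x_σ` has to lie in all the primes `P` for which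
`f(σ, σ⁻¹)` is a unit. -/
def crossedProductRadical : Submodule V (CrossedProduct f) where
  carrier := {a | ∀ (σ : Gal(K/F)) (P : HeightOneSpectrum (integralClosure V K)),
    P.valuation K (a σ) ≤ exp (-f.radicalOrd P σ)}
  zero_mem' := fun σ P => by simp
  add_mem' := fun ha hb σ P => Valuation.map_add_le _ (ha σ P) (hb σ P)
  smul_mem' := fun r a ha σ P => by
    rw [CrossedProduct.smul_apply, Algebra.smul_def,
      IsScalarTower.algebraMap_apply V (integralClosure V K) K, map_mul]
    exact (mul_le_mul' (P.valuation_le_one _) (ha σ P)).trans_eq (one_mul _)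

variable {f}

theorem apply_mem_integralClosure_of_mem_radical {a : CrossedProduct f}
    (ha : a ∈ crossedProductRadical V f) (σ : Gal(K/F)) : a σ ∈ integralClosure V K := by
  by_cases h : a σ = 0
  · rw [h]; exact zero_mem _
  · exact mem_integralClosure_of_ord_nonneg fun P =>
      (f.radicalOrd_nonneg P σ).trans ((P.valuation_le_exp_neg_iff h _).1 (ha σ P))

theorem single_mem_leftOrder_crossedProductRadical {σ : Gal(K/F)} {c : K}
    (h : ∀ (P : HeightOneSpectrum (integralClosure V K)) (τ : Gal(K/F)),
      f.radicalOrd P (σ * τ) ≤ P.ord c + (f.radicalOrd (P.twist σ) τ + f.ord P σ τ)) :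
    single σ c ∈ (crossedProductRadical V f).leftOrder := by
  intro a ha γ P
  rw [single_mul_apply]
  by_cases hc : c = 0
  · simp [hc]
  by_cases hz : a (σ⁻¹ * γ) = 0
  · simp [hz]
  have hσ : σ (a (σ⁻¹ * γ)) ≠ 0 := by rwa [ne_eq, EmbeddingLike.map_eq_zero_iff]
  have hcσ := mul_ne_zero hc hσ
  have hv := f.val_ne_zero σ (σ⁻¹ * γ)
  rw [P.valuation_le_exp_neg_iff (mul_ne_zero hcσ hv), P.ord_mul hcσ hv, P.ord_mul hc hσ,
    HeightOneSpectrum.ord_apply]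
  have h1 := ((P.twist σ).valuation_le_exp_neg_iff hz _).1 (ha (σ⁻¹ * γ) (P.twist σ))
  have h2 := h P (σ⁻¹ * γ)
  rw [mul_inv_cancel_left] at h2
  change _ ≤ _ + _ + f.ord P σ (σ⁻¹ * γ)
  omega

theorem crossedProductOrder_le_leftOrder
    (hf : ∀ σ τ : Gal(K/F), f.val σ τ ∈ integralClosure V K) :
    crossedProductOrder V f hf ≤ (crossedProductRadical V f).leftOrder := by
  intro a ha
  rw [← sum_single a]
  refine sum_mem fun σ _ => single_mem_leftOrder_crossedProductRadical fun P τ => ?_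
  have h1 := f.radicalOrd_mul_le P hf σ τ
  have h2 := ord_nonneg_of_mem_integralClosure (ha σ) P
  omega

theorem algebraMap_mem_crossedProductRadical {v : V}
    (hv : ∀ P : HeightOneSpectrum (integralClosure V K),
      algebraMap V (integralClosure V K) v ∈ P.asIdeal) :
    algebraMap V (CrossedProduct f) v ∈ crossedProductRadical V f := by
  intro σ P
  rw [algebraMap_eq_single]
  by_cases hσ : σ = 1
  · subst hσ
    have h1 := f.radicalOrd_le_one P 1
    have h2 := hv P
    rw [← pow_one P.asIdeal, ← HeightOneSpectrum.intValuation_le_pow_iff_mem,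
      ← P.valuation_of_algebraMap (K := K)] at h2
    rw [single_same]
    refine h2.trans (exp_le_exp.2 ?_)
    push_cast
    omega
  · rw [single_of_ne hσ]; simp

/-- Since v · 1 lies in the radical, every x in its left order satisfies v x = x v ∈ A_f.
Multiplication by v thus embeds the left order into a Noetherian V-module. -/
theorem isVOrder_leftOrder_crossedProductRadical [IsDomain V] [IsNoetherianRing V]
    [Module.Finite V (integralClosure V K)]
    (hf : ∀ σ τ : Gal(K/F), f.val σ τ ∈ integralClosure V K) {v : V} (hv0 : v ≠ 0)
    (hv : ∀ P : HeightOneSpectrum (integralClosure V K),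
      algebraMap V (integralClosure V K) v ∈ P.asIdeal) :
    IsVOrder V F (crossedProductRadical V f).leftOrder := by
  have hA : IsVOrder V F (crossedProductOrder V f hf) := isVOrder_crossedProductOrder
  refine ⟨?_, eq_top_iff.2 (hA.span_eq_top.ge.trans
    (Submodule.span_mono (crossedProductOrder_le_leftOrder hf)))⟩
  have := isNoetherian_of_fg_of_noetherian _ hA.fg
  let φ : CrossedProduct f →ₗ[V] CrossedProduct f := LinearMap.lsmul V _ v
  have hφ : Function.Injective φ := by
    intro a b hab
    have hvK : algebraMap V F v ≠ 0 := by simpa using hv0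
    ext σ
    have h := congrFun hab σ
    change v • a σ = v • b σ at h
    rw [← algebraMap_smul F v, ← algebraMap_smul F v] at h
    exact smul_right_injective K hvK h
  refine Submodule.fg_of_fg_map_injective φ hφ ?_
  have hle : (Subalgebra.toSubmodule (crossedProductRadical V f).leftOrder).map φ ≤
      Subalgebra.toSubmodule (crossedProductOrder V f hf) := by
    rintro _ ⟨x, hx, rfl⟩
    have h := hx _ (algebraMap_mem_crossedProductRadical hv)
    rw [← Algebra.commutes, ← Algebra.smul_def] at h
    exact apply_mem_integralClosure_of_mem_radical h
  exact (isNoetherian_submodule.1 this) _ hle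

/-- If `A_f` is a maximal order then no `f(τ, τ⁻¹)` lies in the square of a prime. -/
theorem ord_lt_two_of_isMaximalVOrder [IsDomain V] [IsNoetherianRing V]
    [Module.Finite V (integralClosure V K)]
    (hf : ∀ σ τ : Gal(K/F), f.val σ τ ∈ integralClosure V K) {v : V} (hv0 : v ≠ 0)
    (hv : ∀ P : HeightOneSpectrum (integralClosure V K),
      algebraMap V (integralClosure V K) v ∈ P.asIdeal)
    (hmax : IsMaximalVOrder V F (crossedProductOrder V f hf))
    (P : HeightOneSpectrum (integralClosure V K)) (τ : Gal(K/F)) : f.ord P τ τ⁻¹ < 2 := by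
  by_contra! h
  obtain ⟨σ, hσ, hσ'⟩ := f.exists_maximal_of_two_le_ord P hf h
  obtain ⟨c, hc, hcP, hcQ⟩ := P.exists_ord_ge_neg_one (K := K)
  have hle := hmax.2 (isVOrder_leftOrder_crossedProductRadical hf hv0 hv)
    (crossedProductOrder_le_leftOrder hf)
  -- By maximality the left order is A_f, so c x_σ in it would make c integral. The pole of c at P
  -- is absorbed by the gain of 1 in `radicalOrd_mul_add_one_le`.
  refine hc ⟨⟨c, single_mem_crossedProductOrder.1 (hle (x := single σ c) ?_)⟩, rfl⟩
  refine single_mem_leftOrder_crossedProductRadical fun Q γ => ?_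
  by_cases hQ : Q = P
  · subst hQ
    have := f.radicalOrd_mul_add_one_le Q hf hσ hσ' γ
    omega
  · have := f.radicalOrd_mul_le Q hf σ γ
    have := hcQ Q hQ
    omega

end

/-! ### Sufficiency: elements of an overorder. -/

section

variable {V F K : Type*} [CommRing V] [Field F] [Field K] [Algebra V F] [Algebra F K]
  [Algebra V K] [IsScalarTower V F K] [IsFractionRing V F] [FiniteDimensional F K]
  [IsDedekindDomain (integralClosure V K)] [IsFractionRing (integralClosure V K) K]
  {f : NormalizedTwoCocycle F K} (hf : ∀ σ τ : Gal(K/F), f.val σ τ ∈ integralClosure V K)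

open CrossedProduct

/-- The determinant trick: multiplication by c preserves the nonzero finitely generated V-module B
inside a K-vector space. -/
theorem mem_integralClosure_of_single_one_mem {B : Subalgebra V (CrossedProduct f)}
    (hB : B.toSubmodule.FG) {c : K} (hc : single 1 c ∈ B) : c ∈ integralClosure V K := by
  have : IsScalarTower V K (CrossedProduct f) :=
    ⟨fun r x a => CrossedProduct.ext fun σ => smul_assoc r x (a σ)⟩
  have : Module.IsTorsionFree K (CrossedProduct f) :=
    inferInstanceAs (Module.IsTorsionFree K (Gal(K/F) → K))
  refine isIntegral_of_smul_mem_submodule (Subalgebra.toSubmodule B) ?_ hB c fun a ha => ?_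
  · refine (Submodule.ne_bot_iff _).2 ⟨1, B.one_mem, fun h => ?_⟩
    have := congrFun h 1
    rw [one_eq_single] at this
    exact one_ne_zero ((single_same (f := f) 1 (1 : K)).symm.trans this)
  · have : c • a = single 1 c * a := CrossedProduct.ext fun σ => by
      rw [single_one_mul_apply]; rfl
    rw [this]
    exact B.mul_mem hc ha

section overorder

variable {B : Subalgebra V (CrossedProduct f)} {P : HeightOneSpectrum (integralClosure V K)}

/-- An overorder of `A_f` coincides with `A_f` at the elements of the decomposition group of `P`. -/
theorem ord_nonneg_of_single_mem_of_twist_eq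
    (hf : ∀ σ τ : Gal(K/F), f.val σ τ ∈ integralClosure V K) (hB : B.toSubmodule.FG)
    (h : ∀ τ : Gal(K/F), P.twist τ = P → f.ord P τ τ⁻¹ < 2) {σ : Gal(K/F)}
    (hσ : P.twist σ = P) {a : K} (ha : single σ a ∈ B) : 0 ≤ P.ord a := by
  by_cases ha0 : a = 0
  · simp [ha0, HeightOneSpectrum.ord]
  have hpow : ∀ n : ℕ, P.twist (σ ^ n) = P := by
    intro n
    induction n with
    | zero => rw [pow_zero, HeightOneSpectrum.twist_one]
    | succ n ih => rw [pow_succ, HeightOneSpectrum.twist_mul, ih, hσ]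
  -- Here c is the coefficient of the (n + 1)-st power of a x_σ: n + 1 conjugates of a, each of
  -- valuation v_P(a) as σ fixes P, times n cocycle values of valuation at most 1.
  have key : ∀ n : ℕ, ∃ c : K, c ≠ 0 ∧ single (σ ^ (n + 1)) c ∈ B ∧
      P.ord c ≤ (n + 1) * P.ord a + n := by
    intro n
    induction n with
    | zero => exact ⟨a, ha0, by simpa using ha, by simp⟩
    | succ n ih =>
      obtain ⟨c, hc0, hc, hle⟩ := ih
      have hmem := B.mul_mem hc ha
      rw [single_mul_single, ← pow_succ] at hmem
      have haσ : (σ ^ (n + 1)) a ≠ 0 := by rwa [ne_eq, EmbeddingLike.map_eq_zero_iff]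
      have hv := f.val_ne_zero (σ ^ (n + 1)) σ
      refine ⟨_, mul_ne_zero (mul_ne_zero hc0 haσ) hv, hmem, ?_⟩
      rw [P.ord_mul (mul_ne_zero hc0 haσ) hv, P.ord_mul hc0 haσ, HeightOneSpectrum.ord_apply, hpow]
      have h1 := f.ord_le_right P hf (σ ^ (n + 1)) σ
      rw [hpow] at h1
      have h2 := h σ hσ
      change _ + _ + f.ord P (σ ^ (n + 1)) σ ≤ _
      push_cast
      linarith
  -- Now σ^(n+1) = 1, so c is integral; but v_P(a) ≤ -1 would give v_P(c) ≤ -(n + 1) + n = -1.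
  obtain ⟨c, hc0, hc, hle⟩ := key (orderOf σ - 1)
  have hpos := orderOf_pos σ
  rw [Nat.sub_add_cancel hpos, pow_orderOf_eq_one] at hc
  have h0 := ord_nonneg_of_mem_integralClosure (mem_integralClosure_of_single_one_mem hB hc) P
  by_contra! hneg
  have : ((orderOf σ - 1 : ℕ) + 1 : ℤ) * P.ord a ≤ ((orderOf σ - 1 : ℕ) + 1 : ℤ) * (-1) :=
    mul_le_mul_of_nonneg_left (by omega) (by positivity)
  linarith

/-- Choose α carrying P to Q and β carrying ρ⁻¹(Q) back to P, in the sense of `twist`. Then x_α (a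
x_ρ) x_β lies over αρβ, which fixes P, and its coefficient has v_P equal to v_Q(a), since
`ord_le_left` and `ord_le_right` bound the two cocycle factors by 0. -/
theorem ord_nonneg_of_single_mem (hB : B.toSubmodule.FG)
    (hle : crossedProductOrder V f hf ≤ B)
    (htrans : ∀ Q Q' : HeightOneSpectrum (integralClosure V K),
      ∃ σ : Gal(K/F), Q.twist σ = Q' ∧ f.ord Q σ σ⁻¹ = 0)
    (h : ∀ τ : Gal(K/F), P.twist τ = P → f.ord P τ τ⁻¹ < 2) {ρ : Gal(K/F)}
    {a : K} (ha : single ρ a ∈ B) (Q : HeightOneSpectrum (integralClosure V K)) :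
    0 ≤ Q.ord a := by
  by_cases ha0 : a = 0
  · simp [ha0, HeightOneSpectrum.ord]
  obtain ⟨α, hα, hα0⟩ := htrans P Q
  obtain ⟨β, hβ, hβ0⟩ := htrans (Q.twist ρ) P
  have hone : ∀ σ : Gal(K/F), single σ (1 : K) ∈ B := fun σ =>
    hle (single_mem_crossedProductOrder.2 (one_mem _))
  have hmem := B.mul_mem (B.mul_mem (hone α) ha) (hone β)
  rw [single_mul_single, single_mul_single, map_one, one_mul, mul_one] at hmem
  have haα : α a ≠ 0 := by rwa [ne_eq, EmbeddingLike.map_eq_zero_iff]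
  have hv := f.val_ne_zero α ρ
  have hv' := f.val_ne_zero (α * ρ) β
  have htw : P.twist (α * ρ) = Q.twist ρ := by rw [HeightOneSpectrum.twist_mul, hα]
  have h0 := ord_nonneg_of_single_mem_of_twist_eq hf hB h
    (by rw [HeightOneSpectrum.twist_mul, htw, hβ]) hmem
  rw [P.ord_mul (mul_ne_zero haα hv) hv', P.ord_mul haα hv, HeightOneSpectrum.ord_apply, hα] at h0
  have h1 := f.ord_le_left P hf α ρ
  have h2 := f.ord_le_right P hf (α * ρ) β
  rw [htw] at h2
  change 0 ≤ _ + f.ord P α ρ + f.ord P (α * ρ) β at h0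
  omega

end overorder

theorem isMaximalVOrder_of_ord_lt_two [IsDomain V] [Module.Finite V (integralClosure V K)]
    [Algebra.FormallyUnramified V (integralClosure V K)]
    (htrans : ∀ Q Q' : HeightOneSpectrum (integralClosure V K),
      ∃ σ : Gal(K/F), Q.twist σ = Q' ∧ f.ord Q σ σ⁻¹ = 0)
    {P : HeightOneSpectrum (integralClosure V K)}
    (h : ∀ τ : Gal(K/F), P.twist τ = P → f.ord P τ τ⁻¹ < 2) :
    IsMaximalVOrder V F (crossedProductOrder V f hf) := by
  refine ⟨isVOrder_crossedProductOrder, fun B hB hle b hb σ => ?_⟩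
  have hs : ∀ s ∈ integralClosure V K, single 1 s ∈ B := fun s hs =>
    hle (single_mem_crossedProductOrder.2 hs)
  have hσ := single_apply_mem V (Subalgebra.toSubmodule B).toAddSubgroup
    (fun s h b hb => B.mul_mem (hs s h) hb) (fun s h b hb => B.mul_mem hb (hs s h)) hb σ
  exact mem_integralClosure_of_ord_nonneg
    (ord_nonneg_of_single_mem hf hB.fg hle htrans h hσ)

/-! ### Consequences of primarity: conjugating the primes by units. -/

/-- The coefficient at `x_1`. -/
def coeffOne : crossedProductOrder V f hf →+ integralClosure V K where
  toFun a := ⟨a.1 1, a.2 1⟩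
  map_zero' := rfl
  map_add' _ _ := rfl

/-- The inclusion of `S` into `A_f`. -/
def coeffInclusion (s : integralClosure V K) : crossedProductOrder V f hf :=
  ⟨single 1 (s : K), single_mem_crossedProductOrder.2 s.2⟩

theorem coeffOne_mul_coeffInclusion (a : crossedProductOrder V f hf) (s : integralClosure V K) :
    coeffOne hf (a * coeffInclusion hf s) = coeffOne hf a * s :=
  Subtype.ext (mul_single_one_apply (s : K) a.1 1)

theorem coeffOne_coeffInclusion (s : integralClosure V K) :
    coeffOne hf (coeffInclusion hf s) = s :=
  Subtype.ext (single_same (f := f) 1 (s : K))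

theorem coeffOne_one : coeffOne hf 1 = 1 :=
  Subtype.ext (by
    change (1 : CrossedProduct f) 1 = 1
    rw [one_eq_single, single_same])

theorem coeffOne_mul (a b : crossedProductOrder V f hf) :
    coeffOne hf (a * b) = ∑ σ : Gal(K/F), (⟨a.1 σ, a.2 σ⟩ : integralClosure V K) *
      galRestrict V F K (integralClosure V K) σ ⟨b.1 σ⁻¹, b.2 σ⁻¹⟩ * ⟨f.val σ σ⁻¹, hf σ σ⁻¹⟩ := by
  refine Subtype.ext ((mul_apply a.1 b.1 1).trans ?_)
  rw [AddSubmonoidClass.coe_finsetSum]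
  refine Finset.sum_congr rfl fun σ _ => ?_
  have h := algebraMap_galRestrict_apply (L := K) V (B := integralClosure V K) σ
    ⟨b.1 σ⁻¹, b.2 σ⁻¹⟩
  change ((galRestrict V F K (integralClosure V K) σ ⟨b.1 σ⁻¹, b.2 σ⁻¹⟩ :
    integralClosure V K) : K) = σ (b.1 σ⁻¹) at h
  rw [MulMemClass.coe_mul, MulMemClass.coe_mul, h, mul_one]

/-- The radical is graded, so it contains the x_1-component s of j. If s ∉ P, then y s + i = 1 with
i ∈ P, so i is left invertible modulo the radical, hence left invertible in A_f. Comparing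
coefficients at x_1 makes i a unit of S, which is absurd. -/
theorem coeffOne_mem_of_mem_jacobson [Module.Finite V (integralClosure V K)]
    [Algebra.FormallyUnramified V (integralClosure V K)]
    (P : HeightOneSpectrum (integralClosure V K)) {j : crossedProductOrder V f hf}
    (hj : j ∈ Ring.jacobson (crossedProductOrder V f hf)) : coeffOne hf j ∈ P.asIdeal := by
  set J := Ring.jacobson (crossedProductOrder V f hf)
  have hmem : coeffInclusion hf (coeffOne hf j) ∈ J := by
    obtain ⟨y, hy, hy'⟩ := single_apply_mem V
      (J.toAddSubgroup.map (crossedProductOrder V f hf).val.toAddMonoidHom)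
      (by
        rintro s hs _ ⟨y, hy, rfl⟩
        exact ⟨coeffInclusion hf ⟨s, hs⟩ * y, J.mul_mem_left _ hy, rfl⟩)
      (by
        rintro s hs _ ⟨y, hy, rfl⟩
        exact ⟨y * coeffInclusion hf ⟨s, hs⟩, J.mul_mem_right _ hy, rfl⟩)
      ⟨j, hj, rfl⟩ 1
    rwa [show y = coeffInclusion hf (coeffOne hf j) from Subtype.ext hy'] at hy
  by_contra hP
  obtain ⟨y, i, hi, hyi⟩ := P.isMaximal.exists_inv hP
  have htop : Ideal.span {coeffInclusion hf i} = ⊤ := by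
    by_contra hne
    obtain ⟨m, hm, hle⟩ := Ideal.exists_le_maximal _ hne
    refine hm.ne_top ((Ideal.eq_top_iff_one m).2 ?_)
    have h1 : (1 : crossedProductOrder V f hf) =
        coeffInclusion hf y * coeffInclusion hf (coeffOne hf j) + coeffInclusion hf i := by
      refine Subtype.ext (CrossedProduct.ext fun σ => ?_)
      have h2 : (y : K) * (coeffOne hf j : K) + i = 1 := congrArg Subtype.val hyi
      change (1 : CrossedProduct f) σ = (single 1 (y : K) * single 1 (coeffOne hf j : K) :
        CrossedProduct f) σ + (single 1 (i : K) : CrossedProduct f) σ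
      rw [one_eq_single, single_one_mul_apply]
      by_cases hσ : σ = 1
      · subst hσ; rw [single_same, single_same, single_same, h2]
      · rw [single_of_ne hσ, single_of_ne hσ, single_of_ne hσ]; simp
    rw [h1]
    exact m.add_mem (m.mul_mem_left _ (Ring.jacobson_le_of_isMaximal m hmem))
      (hle (Ideal.subset_span rfl))
  obtain ⟨c, hc⟩ := Ideal.mem_span_singleton'.1 ((Ideal.eq_top_iff_one _).1 htop)
  have h2 := congrArg (coeffOne hf) hc
  rw [coeffOne_mul_coeffInclusion, coeffOne_one] at h2
  exact P.isPrime.ne_top ((Ideal.eq_top_iff_one _).2 (h2 ▸ P.asIdeal.mul_mem_left _ hi))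

/-- The largest two-sided ideal of `A_f` whose coefficients at `x_1` lie in `P`. -/
def coeffOneIdeal (P : HeightOneSpectrum (integralClosure V K)) :
    Ideal (crossedProductOrder V f hf) where
  carrier := {a | ∀ x y, coeffOne hf (x * a * y) ∈ P.asIdeal}
  zero_mem' := fun x y => by simp
  add_mem' := fun ha hb x y => by
    rw [mul_add, add_mul, map_add]; exact P.asIdeal.add_mem (ha x y) (hb x y)
  smul_mem' := fun c a ha x y => by
    rw [smul_eq_mul, ← mul_assoc]; exact ha (x * c) y

instance (P : HeightOneSpectrum (integralClosure V K)) : (coeffOneIdeal hf P).IsTwoSided :=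
  ⟨fun b ha x y => by rw [← mul_assoc, mul_assoc]; exact ha x (b * y)⟩

theorem one_notMem_coeffOneIdeal (P : HeightOneSpectrum (integralClosure V K)) :
    (1 : crossedProductOrder V f hf) ∉ coeffOneIdeal hf P := fun h => by
  have h1 : coeffOne hf (1 * 1 * 1) ∈ P.asIdeal := h 1 1
  rw [one_mul, one_mul, coeffOne_one] at h1
  exact P.isPrime.ne_top ((Ideal.eq_top_iff_one _).2 h1)

theorem jacobson_le_coeffOneIdeal [Module.Finite V (integralClosure V K)]
    [Algebra.FormallyUnramified V (integralClosure V K)]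
    (P : HeightOneSpectrum (integralClosure V K)) :
    Ring.jacobson (crossedProductOrder V f hf) ≤ coeffOneIdeal hf P := fun _ hj x y =>
  coeffOne_mem_of_mem_jacobson hf P (Ideal.mul_mem_right y _ (Ideal.mul_mem_left _ x hj))

theorem exists_notMem_forall_mem_twist (P Q : HeightOneSpectrum (integralClosure V K)) :
    ∃ s : integralClosure V K, s ∉ Q.asIdeal ∧
      ∀ σ : Gal(K/F), P.twist σ ≠ Q → s ∈ (P.twist σ).asIdeal := by
  have hs : ∀ σ : Gal(K/F), ∃ s : integralClosure V K, s ∉ Q.asIdeal ∧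
      (P.twist σ ≠ Q → s ∈ (P.twist σ).asIdeal) := by
    intro σ
    by_cases hσ : P.twist σ = Q
    · exact ⟨1, fun h => Q.isPrime.ne_top ((Ideal.eq_top_iff_one _).2 h), fun h => absurd hσ h⟩
    · have : ¬ (P.twist σ).asIdeal ≤ Q.asIdeal := fun h =>
        hσ (HeightOneSpectrum.ext ((P.twist σ).isMaximal.eq_of_le Q.isPrime.ne_top h))
      obtain ⟨s, h1, h2⟩ := Set.not_subset.1 this
      exact ⟨s, h2, fun _ => h1⟩
  choose s hsQ hsP using hs
  refine ⟨∏ σ, s σ, fun h => ?_, fun σ hσ => ?_⟩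
  · obtain ⟨σ, -, hσ⟩ := (Q.isPrime.prod_mem_iff).1 h
    exact hsQ σ hσ
  · exact Ideal.mem_of_dvd _ (Finset.dvd_prod_of_mem s (Finset.mem_univ σ)) (hsP σ hσ)

/-- The coefficient of x s y at x_1 is a sum of multiples of σ(s) f(σ,σ⁻¹). Each term lies in P,
through f(σ,σ⁻¹) or, when that is a unit at P, through σ(s). -/
theorem coeffInclusion_mem_coeffOneIdeal {P : HeightOneSpectrum (integralClosure V K)}
    {s : integralClosure V K}
    (h : ∀ σ : Gal(K/F), f.ord P σ σ⁻¹ = 0 → s ∈ (P.twist σ).asIdeal) :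
    coeffInclusion hf s ∈ coeffOneIdeal hf P := by
  intro x y
  rw [coeffOne_mul]
  refine P.asIdeal.sum_mem fun σ _ => ?_
  by_cases hσ : f.ord P σ σ⁻¹ = 0
  · refine P.asIdeal.mul_mem_right _ (P.asIdeal.mul_mem_right _ ?_)
    have h2 : (⟨(x * coeffInclusion hf s).1 σ, (x * coeffInclusion hf s).2 σ⟩ :
        integralClosure V K) = ⟨x.1 σ, x.2 σ⟩ * galRestrict V F K (integralClosure V K) σ s := by
      refine Subtype.ext ((mul_single_one_apply (s : K) x.1 σ).trans ?_)
      rw [MulMemClass.coe_mul]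
      exact congrArg _ (algebraMap_galRestrict_apply (L := K) V σ s).symm
    rw [h2]
    exact P.asIdeal.mul_mem_left _ (h σ hσ)
  · refine P.asIdeal.mul_mem_left _ ?_
    by_contra hP
    exact hσ ((P.ord_algebraMap_eq_zero_iff (K := K) fun h0 =>
      f.val_ne_zero σ σ⁻¹ (congrArg Subtype.val h0)).2 hP)

/-- If `A_f` is primary, then any two primes are conjugate by some `σ` such that `f(σ, σ⁻¹)` is a
unit at the first of them. -/
theorem exists_twist_eq_of_isPrimaryOrder [Module.Finite V (integralClosure V K)]
    [Algebra.FormallyUnramified V (integralClosure V K)]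
    (hprimary : IsPrimaryOrder (crossedProductOrder V f hf))
    (P Q : HeightOneSpectrum (integralClosure V K)) :
    ∃ σ : Gal(K/F), P.twist σ = Q ∧ f.ord P σ σ⁻¹ = 0 := by
  by_contra! hne
  obtain ⟨s, hsQ, hsP⟩ := exists_notMem_forall_mem_twist (F := F) P Q
  have hmem : coeffInclusion hf s ∈ coeffOneIdeal hf P :=
    coeffInclusion_mem_coeffOneIdeal hf fun σ hσ => hsP σ fun h => hne σ h hσ
  have : Nontrivial (crossedProductOrder V f hf ⧸ coeffOneIdeal hf P) :=
    ⟨Ideal.Quotient.mk _ 1, 0, fun h =>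
      one_notMem_coeffOneIdeal hf P (Ideal.Quotient.eq_zero_iff_mem.1 h)⟩
  have : IsSimpleRing (crossedProductOrder V f hf ⧸
      Ring.jacobson (crossedProductOrder V f hf)) := hprimary
  -- Simplicity of A_f modulo its radical forces `coeffOneIdeal hf P` to be the radical. So s lies
  -- in the radical, hence in Q, against its choice.
  have hinj := RingHom.injective (Ideal.Quotient.factor (jacobson_le_coeffOneIdeal hf P))
  have hmk : Ideal.Quotient.factor (jacobson_le_coeffOneIdeal hf P)
      (Ideal.Quotient.mk _ (coeffInclusion hf s)) = 0 :=
    (Ideal.Quotient.factor_mk _ _).trans (Ideal.Quotient.eq_zero_iff_mem.2 hmem)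
  have h1 := coeffOne_mem_of_mem_jacobson hf Q
    (Ideal.Quotient.eq_zero_iff_mem.1 ((map_eq_zero_iff _ hinj).1 hmk))
  rw [coeffOne_coeffInclusion] at h1
  exact hsQ h1

end

end

/-! ### The equivalence. -/

theorem corollary3 {V F K : Type*} [CommRing V] [IsDomain V] [IsDiscreteValuationRing V]
    [Field F] [Algebra V F] [IsFractionRing V F]
    [Field K] [Algebra F K] [FiniteDimensional F K] [IsGalois F K]
    [Algebra V K] [IsScalarTower V F K]
    [Algebra.FormallyUnramified V (integralClosure V K)]
    (f : NormalizedTwoCocycle F K)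
    (hf : ∀ σ τ : Gal(K/F), f.val σ τ ∈ integralClosure V K)
    (hprimary : IsPrimaryOrder (crossedProductOrder V f hf)) :
    IsMaximalVOrder V F (crossedProductOrder V f hf) ↔
      ∃ M : Ideal (integralClosure V K), M.IsMaximal ∧
        ∀ τ ∈ decompositionGroup V F M,
          (⟨f.val τ τ⁻¹, hf τ τ⁻¹⟩ : integralClosure V K) ∉ M ^ 2 := by
  have : IsDedekindDomain (integralClosure V K) := integralClosure.isDedekindDomain V F K
  have : IsFractionRing (integralClosure V K) K :=
    integralClosure.isFractionRing_of_finite_extension F K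
  have : Module.Finite V (integralClosure V K) :=
    IsIntegralClosure.finite V F K (integralClosure V K)
  have hinj : Function.Injective (algebraMap V (integralClosure V K)) := by
    have : Function.Injective (algebraMap V K) := by
      rw [IsScalarTower.algebraMap_eq V F K]
      exact (algebraMap F K).injective.comp (IsFractionRing.injective V F)
    exact Function.Injective.of_comp (f := algebraMap (integralClosure V K) K) this
  have hfield : ¬ IsField (integralClosure V K) := fun h =>
    IsDiscreteValuationRing.not_isField V (isField_of_isIntegral_of_isField hinj h)
  have hsq : ∀ (P : HeightOneSpectrum (integralClosure V K)) (τ : Gal(K/F)),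
      (⟨f.val τ τ⁻¹, hf τ τ⁻¹⟩ : integralClosure V K) ∉ P.asIdeal ^ 2 ↔ f.ord P τ τ⁻¹ < 2 := by
    intro P τ
    rw [← P.le_ord_algebraMap_iff (K := K) fun h0 =>
      f.val_ne_zero τ τ⁻¹ (congrArg Subtype.val h0), not_le]
    rfl
  constructor
  · intro hmax
    obtain ⟨v, hv, hv0⟩ := Submodule.exists_mem_ne_zero_of_ne_bot
      (IsDiscreteValuationRing.not_a_field V)
    obtain ⟨M, hM⟩ := Ideal.exists_maximal (integralClosure V K)
    obtain ⟨P, rfl⟩ : ∃ P : HeightOneSpectrum (integralClosure V K), P.asIdeal = M :=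
      ⟨⟨M, hM.isPrime, Ring.ne_bot_of_isMaximal_of_not_isField hM hfield⟩, rfl⟩
    refine ⟨P.asIdeal, hM, fun τ _ => (hsq P τ).2 (ord_lt_two_of_isMaximalVOrder hf hv0 ?_ hmax P τ)⟩
    intro Q
    have : Q.asIdeal.IsMaximal := Q.isMaximal
    -- By integrality every prime Q contracts to the maximal ideal of V, so the single element v
    -- lies in all of them.
    have := Ideal.isMaximal_comap_of_isIntegral_of_isMaximal (R := V) Q.asIdeal
    rw [← IsLocalRing.eq_maximalIdeal this] at hv
    exact hv
  · rintro ⟨M, hM, h⟩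
    obtain ⟨P, rfl⟩ : ∃ P : HeightOneSpectrum (integralClosure V K), P.asIdeal = M :=
      ⟨⟨M, hM.isPrime, Ring.ne_bot_of_isMaximal_of_not_isField hM hfield⟩, rfl⟩
    exact isMaximalVOrder_of_ord_lt_two hf (exists_twist_eq_of_isPrimaryOrder hf hprimary) (P := P)
      fun τ hτ => (hsq P τ).1 (h τ (HeightOneSpectrum.mem_decompositionGroup_iff.2 hτ))
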